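/- **Theorem 3.2.** Let $r \ge 2$ be a fixed integer. Let $H(n,r,1/2)$ be the random $r$-uniform hypergraph on the vertex set $[n]$ in which each $r$-element subset of $[n]$ is an edge independently with probability $1/2$. *Triangles.* A triangle of a hypergraph $H=(V,E)$ is a closed path $v_0,e_0,v_1,e_1,v_2,e_2$ with $v_i\in V$, $e_i\in E$ and $v_i\in e_{i-1}\cap e_i$ (indices modulo $3$), considered up to the choice of the starting vertex and of the direction of traversal. It is *simple* if $v_0,v_1,v_2$ are distinct and $e_0,e_1,e_2$ are distinct, and *induced* if it is simple and $v_i\notin e_{i+1}$ for all $i$. In the triangle listing problem each vertex $v$ outputs a set $\mathcal T_v$ of triangles of $H$ such that $\bigcup_v\mathcal T_v$ is the set of all triangles of $H$; there are three variants, according to whether all, only the simple, or only the induced triangles are meant. *Models.* The vertices of $H$ are computing entities. Initially each vertex knows $n$, its own identifier in $[n]$, and its incident edges (as sets of identifiers). Computation proceeds in synchronous rounds; local computation is unrestricted and may be randomized (private or shared random bits, independent of $H$) or deterministic. In each round of the CLIQUE model each vertex can send a message of at most $B$ bits to every other vertex, with possibly different messages for different recipients; in the PRIMAL CONGEST model it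 can do so only for the vertices with which it shares an edge. Here $B=O(\log n)$. Each vertex terminates at some time, with an output; the number of rounds of an execution is the time at which the last vertex terminates. Then there is a constant $p<1$, depending only on $r$, such that for every constant $C$ there is $c>0$, depending only on $r$ and $C$, with the following property for all sufficiently large $n$ (depending on $r$ and $C$) and all $B\le C\log n$: every randomized or deterministic algorithm in the CLIQUE model which, on input $H\sim H(n,r,1/2)$, solves triangle listing (in any of the three variants) with probability at least $p$ over $H$ and the algorithm's random choices uses at least $$c\,\frac{n^{r-5/3}}{\log n}$$ rounds in expectation (and hence in the worst case). The same holds for algorithms in the PRIMAL CONGEST model. -/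

import Mathlib

open MeasureTheory ProbabilityTheory Filter
open scoped ENNReal

noncomputable section

namespace HypergraphTriangles

/-! ### Random uniform hypergraphs -/

/-- The hypergraph on the vertex set `Fin n` with a given set of edges. -/
def ofEdges {n : ℕ} (E : Set (Set (Fin n))) : Hypergraph (Fin n) where
  vertexSet := Set.univ
  edgeSet := E
  subset_vertexSet_of_mem_edgeSet' := fun _ _ => Set.subset_univ _

/-- There are finitely many hypergraphs on `Fin n`; every set of them is an event. -/
instance instMeasurableSpaceHypergraph (n : ℕ) : MeasurableSpace (Hypergraph (Fin n)) := ⊤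

/-- `H(n, r, p)`: every `r`-element subset of the vertex set `Fin n` is an edge with probability
`p`, independently of the others, and there are no other edges. -/
def randomHypergraph (n r : ℕ) (p : unitInterval) : Measure (Hypergraph (Fin n)) :=
  (setBernoulli {e : Set (Fin n) | e.ncard = r} p).map ofEdges

instance instIsProbabilityMeasureRandomHypergraph (n r : ℕ) (p : unitInterval) :
    IsProbabilityMeasure (randomHypergraph n r p) :=
  Measure.isProbabilityMeasure_map (Measurable.of_discrete).aemeasurable

/-- The probability `1 / 2`. -/
def half : unitInterval := ⟨1 / 2, by norm_num, by norm_num⟩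

/-! ### Triangles -/

/-- The data `(v₀, e₀, v₁, e₁, v₂, e₂)` of a (potential) triangle; indices are modulo `3`. -/
structure Triple (n : ℕ) where
  /-- the vertices -/
  v : Fin 3 → Fin n
  /-- the edges -/
  e : Fin 3 → Set (Fin n)

/-- The three usual variants of the notion of a triangle. -/
inductive TriangleKind
  /-- all closed paths of length three -/
  | closedPath
  /-- closed paths of length three with distinct vertices and distinct edges -/
  | simple
  /-- simple triangles in which no vertex lies on the opposite edge (open triangles) -/
  | induced

/-- `T` is a closed path of length three in `H`. -/
def Triple.IsClosedPath {n : ℕ} (H : Hypergraph (Fin n)) (T : Triple n) : Prop :=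
  ∀ i, T.e i ∈ H.edgeSet ∧ T.v i ∈ T.e (i - 1) ∧ T.v i ∈ T.e i

/-- The vertices of `T` are pairwise distinct, and so are its edges. -/
def Triple.IsSimple {n : ℕ} (T : Triple n) : Prop :=
  Function.Injective T.v ∧ Function.Injective T.e

/-- `T` is a triangle of `H` of the given kind. -/
def IsTriangle {n : ℕ} (H : Hypergraph (Fin n)) (T : Triple n) : TriangleKind → Prop
  | .closedPath => T.IsClosedPath H
  | .simple => T.IsClosedPath H ∧ T.IsSimple
  | .induced => T.IsClosedPath H ∧ T.IsSimple ∧ ∀ i, T.v i ∉ T.e (i + 1)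

/-- `T` and `T'` describe the same cyclic sequence, up to the choice of the starting vertex and of
the direction of traversal. -/
def Triple.Same {n : ℕ} (T T' : Triple n) : Prop :=
  (∃ k, ∀ i, T'.v i = T.v (k + i) ∧ T'.e i = T.e (k + i)) ∨
    (∃ k, ∀ i, T'.v i = T.v (k - i) ∧ T'.e i = T.e (k - i - 1))

/-- The local outputs `S v` solve triangle listing on `H`: only triangles of `H` are listed, and
every triangle of `H` is listed (in at least one of its representations) by some vertex. -/
def ListsTriangles {n : ℕ} (K : TriangleKind) (H : Hypergraph (Fin n))
    (S : Fin n → Set (Triple n)) : Prop :=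
  (∀ v, ∀ T ∈ S v, IsTriangle H T K) ∧
    ∀ T, IsTriangle H T K → ∃ v, ∃ T' ∈ S v, T.Same T'

/-! ### Synchronous distributed algorithms -/

/-- The two communication models. -/
inductive Model
  /-- CLIQUE: in each round every vertex can send a message to every other vertex -/
  | clique
  /-- PRIMAL CONGEST: in each round every vertex can send a message to every vertex with which it
  shares an edge -/
  | primalCongest

/-- In the model, `u` can send a message to `v` when the network is `H`. -/
def Model.CanSend {n : ℕ} (H : Hypergraph (Fin n)) (u v : Fin n) : Model → Prop
  | .clique => u ≠ v
  | .primalCongest => u ≠ v ∧ H.Adj u v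

/-- Messages: strings of at most `B` bits. The empty string also stands for silence. -/
def Message (B : ℕ) : Type := {l : List Bool // l.length ≤ B}

/-- The empty message. -/
def Message.silence {B : ℕ} : Message B := ⟨[], Nat.zero_le B⟩

/-- What a vertex has received so far: for each past round, the message from each vertex. -/
abbrev History (n B : ℕ) : Type := List (Fin n → Message B)

/-- The initial knowledge of `v` about the network (`KT₁`): its incident edges, each given as a set
of vertex identifiers. -/
def incidentEdges {n : ℕ} (H : Hypergraph (Fin n)) (v : Fin n) : Set (Set (Fin n)) :=
  {e | e ∈ H.edgeSet ∧ v ∈ e}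

/-- A distributed algorithm for networks on the `n` vertices `Fin n` with messages of at most `B`
bits. Its random choices are a function of a point `ω` of a probability space `Ω`. All vertices may
use all of `ω`, so that shared randomness is allowed; private randomness is the case in which `Ω` is
a product and a vertex uses only its own coordinate, and deterministic algorithms are those that
ignore `ω`. The local computations are unrestricted. -/
structure Algorithm (n B : ℕ) (Ω : Type*) [MeasurableSpace Ω] where
  /-- `send u v ω I h` is the message that `u` addresses to `v` in the next round, where `I` is the
  set of edges incident to `u` and `h` is what `u` has received so far. -/
  send : Fin n → Fin n → Ω → Set (Set (Fin n)) → History n B → Message B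
  /-- `decide v ω I h` is the output of `v` if `v` terminates when its incident edges are `I` and it
  has received `h`, and `none` if `v` goes on. -/
  decide : Fin n → Ω → Set (Set (Fin n)) → History n B → Option (Set (Triple n))
  measurable_send : ∀ u v I h m, MeasurableSet {ω | send u v ω I h = m}
  measurable_decide : ∀ v I h o, MeasurableSet {ω | decide v ω I h = o}

namespace Algorithm

variable {n B : ℕ} {Ω : Type*} [MeasurableSpace Ω]

open Classical in
/-- `A.history M H ω t v` is what `v` has received in the first `t` rounds of the execution. -/
def history (A : Algorithm n B Ω) (M : Model) (H : Hypergraph (Fin n)) (ω : Ω) :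
    ℕ → Fin n → History n B
  | 0, _ => []
  | t + 1, v => A.history M H ω t v ++ [fun u =>
      if M.CanSend H u v then A.send u v ω (incidentEdges H u) (A.history M H ω t u)
      else Message.silence]

/-- The decision of `v` after `t` rounds. -/
def decision (A : Algorithm n B Ω) (M : Model) (H : Hypergraph (Fin n)) (ω : Ω) (t : ℕ)
    (v : Fin n) : Option (Set (Triple n)) :=
  A.decide v ω (incidentEdges H v) (A.history M H ω t v)

/-- `v` terminates after exactly `t` rounds, with output `S`. (Its output is then final. It may keep
answering messages, which only helps the algorithm.) -/
def TerminatesWith (A : Algorithm n B Ω) (M : Model) (H : Hypergraph (Fin n)) (ω : Ω) (v : Fin n)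
    (t : ℕ) (S : Set (Triple n)) : Prop :=
  A.decision M H ω t v = some S ∧ ∀ s < t, A.decision M H ω s v = none

/-- The number of rounds of the execution: the first time by which all vertices have terminated,
and `⊤` if some vertex never does. -/
def rounds (A : Algorithm n B Ω) (M : Model) (H : Hypergraph (Fin n)) (ω : Ω) : ℕ∞ :=
  ⨆ v : Fin n, sInf {τ : ℕ∞ | ∃ (t : ℕ) (S : Set (Triple n)),
    A.TerminatesWith M H ω v t S ∧ τ = (t : ℕ∞)}

/-- In the execution all vertices terminate and their outputs solve triangle listing. -/
def Succeeds (A : Algorithm n B Ω) (M : Model) (K : TriangleKind) (H : Hypergraph (Fin n))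
    (ω : Ω) : Prop :=
  ∃ S : Fin n → Set (Triple n),
    (∀ v, ∃ t, A.TerminatesWith M H ω v t (S v)) ∧ ListsTriangles K H S

/-- The probability that the algorithm solves triangle listing when the network is drawn from `D`
and, independently, the random choices are drawn from `P`. -/
def successProbability (A : Algorithm n B Ω) (M : Model) (K : TriangleKind)
    (D : Measure (Hypergraph (Fin n))) (P : Measure Ω) : ℝ≥0∞ :=
  (D.prod P) {x | A.Succeeds M K x.1 x.2}

/-- The expected number of rounds when the network is drawn from `D` and, independently, the random
choices are drawn from `P`. -/
def expectedRounds (A : Algorithm n B Ω) (M : Model)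
    (D : Measure (Hypergraph (Fin n))) (P : Measure Ω) : ℝ≥0∞ :=
  ∫⁻ x, ((A.rounds M x.1 x.2 : ℕ∞) : ℝ≥0∞) ∂(D.prod P)

end Algorithm

end HypergraphTriangles

end

namespace HypergraphTriangles

/-! ### Counting triangles spanned by a set of edges -/

/-! Put r = s + 2 and fix the random choices. It suffices to look at triangles whose three rows of s
+ 1 vertices are disjoint: they are induced, so each variant has to list them. There are about
n^(3s+3) candidates, each present with probability 1/8, so with constant probability a constant
fraction is present (`randomHypergraph_few_triangles`), and then some vertex lists at least a 1/n
fraction of those. By Cauchy–Schwarz, m edges span only O((m n^s)^(3/2)) of them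
(`ncard_spanned_sq_le`), so the output of that vertex involves at least m = γ n^(s+4/3) edges of H.

This output is a function of the incident edges and the received messages (`TerminatesWith.unique`),
which in T rounds take at most 2^(n^(s+1) + 2BnT) values. For each value the output edges are fixed,
and they all lie in H with probability at most 2^(-m). By a union bound
(`measure_succeedsWithin_le`) success stays bounded away from certainty unless BnT is at least of
order m, that is, T at least of order n^(s+1/3) / log n. A more reliable algorithm therefore exceeds
T rounds with constant probability (`expectedRounds_ge`). Only received messages are counted, so
both models are covered at once. -/

/-- A weighted form of the bound `m ^ (3 / 2)` for the number of triangles spanned by `m` edges. -/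
lemma sum_triangle_sq_le {α : Type*} [Fintype α] (w : α → α → ℝ) :
    (∑ x, ∑ y, ∑ z, w x y * w y z * w z x) ^ 2 ≤ (∑ x, ∑ y, w x y ^ 2) ^ 3 := by
  set Q := ∑ x, ∑ y, w x y ^ 2 with hQ
  have hQ0 : 0 ≤ Q := by positivity
  -- Cauchy–Schwarz is used twice: over the pairs `q = (x, z)`, to split off the closing weight `w z
  -- x`, and then over `y`.
  have h1 : ∑ x, ∑ y, ∑ z, w x y * w y z * w z x =
      ∑ q : α × α, w q.2 q.1 * ∑ y, w q.1 y * w y q.2 := by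
    rw [Fintype.sum_prod_type]
    refine Finset.sum_congr rfl fun x _ => ?_
    rw [Finset.sum_comm]
    refine Finset.sum_congr rfl fun z _ => ?_
    rw [Finset.mul_sum]
    exact Finset.sum_congr rfl fun y _ => by ring
  have h2 : ∑ q : α × α, w q.2 q.1 ^ 2 = Q := by
    rw [Fintype.sum_prod_type, Finset.sum_comm, hQ]
  have h3 : ∑ q : α × α, (∑ y, w q.1 y * w y q.2) ^ 2 ≤ Q * Q := by
    calc ∑ q : α × α, (∑ y, w q.1 y * w y q.2) ^ 2
        ≤ ∑ q : α × α, (∑ y, w q.1 y ^ 2) * ∑ y, w y q.2 ^ 2 :=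
          Finset.sum_le_sum fun q _ => Finset.sum_mul_sq_le_sq_mul_sq _ _ _
      _ = (∑ x, ∑ y, w x y ^ 2) * ∑ z, ∑ y, w y z ^ 2 := by
          rw [Fintype.sum_prod_type, Finset.sum_mul_sum]
      _ = Q * Q := by rw [Finset.sum_comm (f := fun z y => w y z ^ 2)]
  calc (∑ x, ∑ y, ∑ z, w x y * w y z * w z x) ^ 2
      = (∑ q : α × α, w q.2 q.1 * ∑ y, w q.1 y * w y q.2) ^ 2 := by rw [h1]
    _ ≤ (∑ q : α × α, w q.2 q.1 ^ 2) * ∑ q : α × α, (∑ y, w q.1 y * w y q.2) ^ 2 :=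
        Finset.sum_mul_sq_le_sq_mul_sq _ _ _
    _ ≤ Q * (Q * Q) := by rw [h2]; exact mul_le_mul_of_nonneg_left h3 hQ0
    _ = Q ^ 3 := by ring

/-- The `i`-th edge of the triangle with pairwise disjoint rows `f (i, ·)`: it consists of the
`i`-th row and of the first element of the next row. -/
def rowEdge {n s : ℕ} (f : Fin 3 × Fin (s + 1) → Fin n) (i : Fin 3) : Set (Fin n) :=
  insert (f (i + 1, 0)) (Set.range fun j => f (i, j))

/-- The ordered `s`-tuples that complete the pair `u, v` to an edge in `E`. -/
def completions {n : ℕ} (s : ℕ) (E : Set (Set (Fin n))) (u v : Fin n) : Set (Fin s → Fin n) :=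
  {a | insert v (insert u (Set.range a)) ∈ E}

/-- The triangles with edges `rowEdge f i` all of whose edges are in `E`. -/
def spanned {n : ℕ} (s : ℕ) (E : Set (Set (Fin n))) : Set (Fin 3 × Fin (s + 1) ↪ Fin n) :=
  {f | ∀ i, rowEdge f i ∈ E}

lemma mem_completions {n s : ℕ} {E : Set (Set (Fin n))} {u v : Fin n} {a : Fin s → Fin n} :
    a ∈ completions s E u v ↔ insert v (insert u (Set.range a)) ∈ E := Iff.rfl

lemma mem_spanned {n s : ℕ} {E : Set (Set (Fin n))} {f : Fin 3 × Fin (s + 1) ↪ Fin n} :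
    f ∈ spanned s E ↔ ∀ i, rowEdge f i ∈ E := Iff.rfl

lemma ncard_completions_le {n : ℕ} (s : ℕ) (E : Set (Set (Fin n))) (u v : Fin n) :
    (completions s E u v).ncard ≤ n ^ s := by
  refine (Set.ncard_le_card _).trans ?_
  simp [Nat.card_eq_fintype_card]

/-- Each pair with a completion is an (s + 2)-tuple whose range is an edge, and a given set is the
range of at most (s + 2)^(s + 2) such tuples. Uniformity of `E` is not needed, since sets with more
than s + 2 elements are not ranges at all. -/
lemma sum_ncard_completions_le {n : ℕ} (s : ℕ) (E : Set (Set (Fin n))) :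
    ∑ u, ∑ v, (completions s E u v).ncard ≤ (s + 2) ^ (s + 2) * E.ncard := by
  classical
  have h1 : ∑ u, ∑ v, (completions s E u v).ncard =
      (Finset.univ.sigma fun q : Fin n × Fin n =>
        Finset.univ.filter (· ∈ completions s E q.1 q.2)).card := by
    rw [Finset.card_sigma, Fintype.sum_prod_type]
    refine Finset.sum_congr rfl fun u _ => Finset.sum_congr rfl fun v _ => ?_
    rw [← Set.ncard_coe_finset]
    congr 1; ext; simp
  set G : Finset (Fin (s + 2) → Fin n) := Finset.univ.filter (fun g => Set.range g ∈ E) with hG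
  have h2 : ∑ u, ∑ v, (completions s E u v).ncard ≤ G.card := by
    rw [h1]
    refine Finset.card_le_card_of_injOn
      (fun q => Fin.cons q.1.2 (Fin.cons q.1.1 q.2 : Fin (s + 1) → Fin n)) ?_ ?_
    · rintro ⟨⟨u, v⟩, a⟩ h
      simpa [hG, Fin.range_cons, mem_completions] using h
    · rintro ⟨⟨u, v⟩, a⟩ _ ⟨⟨u', v'⟩, a'⟩ _ h
      simp only [Fin.cons_inj] at h
      obtain ⟨rfl, rfl, rfl⟩ := h
      rfl
  refine h2.trans ?_
  have h3 : ∀ e ∈ Finset.univ.filter (· ∈ E), (G.filter (fun g => Set.range g = e)).card ≤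
      (s + 2) ^ (s + 2) := by
    intro e _
    by_cases he : e.ncard ≤ s + 2
    · calc (G.filter (fun g => Set.range g = e)).card
          ≤ (Fintype.piFinset fun _ : Fin (s + 2) => e.toFinset).card := by
            refine Finset.card_le_card fun g hg => ?_
            simp only [Finset.mem_filter] at hg
            simp [Fintype.mem_piFinset, ← hg.2]
        _ = e.ncard ^ (s + 2) := by simp [Set.ncard_eq_toFinset_card']
        _ ≤ _ := Nat.pow_le_pow_left he _
    · rw [Finset.card_eq_zero.2]
      · exact Nat.zero_le _
      · refine Finset.filter_eq_empty_iff.2 fun g _ hg => he ?_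
        rw [← hg, ← Set.image_univ]
        refine (Set.ncard_image_le).trans ?_
        simp [Set.ncard_univ]
  refine (Finset.card_le_mul_card_image_of_maps_to (f := fun g => Set.range g)
    (fun g hg => ?_) _ h3).trans_eq ?_
  · simpa [hG] using hg
  · rw [← Set.ncard_coe_finset]; congr 2; ext; simp

/-- A triangle is determined by the first elements x, y, z of its rows and by the three remaining
parts of the rows; each part completes a consecutive pair of x, y, z to an edge. -/
lemma ncard_spanned_le {n : ℕ} (s : ℕ) (E : Set (Set (Fin n))) :
    (spanned s E).ncard ≤ ∑ x, ∑ y, ∑ z, (completions s E x y).ncard *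
      (completions s E y z).ncard * (completions s E z x).ncard := by
  classical
  have h1 : ∑ x, ∑ y, ∑ z, (completions s E x y).ncard *
      (completions s E y z).ncard * (completions s E z x).ncard =
      (Finset.univ.sigma fun q : Fin n × Fin n × Fin n =>
        ((completions s E q.1 q.2.1).toFinset ×ˢ (completions s E q.2.1 q.2.2).toFinset) ×ˢ
          (completions s E q.2.2 q.1).toFinset).card := by
    rw [Finset.card_sigma, Fintype.sum_prod_type]
    refine Finset.sum_congr rfl fun x _ => ?_
    rw [Fintype.sum_prod_type]
    refine Finset.sum_congr rfl fun y _ => Finset.sum_congr rfl fun z _ => ?_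
    simp only [Finset.card_product, Set.ncard_eq_toFinset_card']
  rw [h1, Set.ncard_eq_toFinset_card']
  have key : ∀ (f : Fin 3 × Fin (s + 1) ↪ Fin n) (i : Fin 3),
      (Set.range fun j => f (i, j)) = insert (f (i, 0)) (Set.range fun j : Fin s => f (i, j.succ)) := by
    intro f i
    ext x
    simp [Fin.exists_fin_succ, eq_comm]
  refine Finset.card_le_card_of_injOn
    (fun f => ⟨(f (0, 0), f (1, 0), f (2, 0)),
      ((fun j => f (0, j.succ), fun j => f (1, j.succ)), fun j => f (2, j.succ))⟩) ?_ ?_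
  · intro f hf
    have hf : ∀ i, rowEdge f i ∈ E := by simpa [mem_spanned] using hf
    have h0 := hf 0
    have h1 := hf 1
    have h2 := hf 2
    simp only [rowEdge, key] at h0 h1 h2
    simp only [Finset.coe_sigma, Set.mem_sigma_iff, Finset.coe_univ, Set.mem_univ, true_and,
      Finset.mem_coe, Finset.mem_product, Set.mem_toFinset, mem_completions]
    exact ⟨⟨h0, h1⟩, h2⟩
  · intro f _ g _ h
    simp only [Sigma.mk.injEq, Prod.mk.injEq, heq_eq_eq, funext_iff] at h
    obtain ⟨⟨h0, h1, h2⟩, ⟨h3, h4⟩, h5⟩ := h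
    ext ⟨i, j⟩
    congr 1
    refine Fin.cases ?_ (fun j => ?_) j <;> fin_cases i
    exacts [h0, h1, h2, h3 j, h4 j, h5 j]

/-- `m` edges of size `s + 2` span at most `O((m n ^ s) ^ (3 / 2))` triangles. -/
lemma ncard_spanned_sq_le {n : ℕ} (s : ℕ) (E : Set (Set (Fin n))) :
    ((spanned s E).ncard : ℝ) ^ 2 ≤
      ((n : ℝ) ^ s * (((s : ℝ) + 2) ^ (s + 2) * E.ncard)) ^ 3 := by
  have h1 : ((spanned s E).ncard : ℝ) ≤ ∑ x, ∑ y, ∑ z, ((completions s E x y).ncard : ℝ) *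
      ((completions s E y z).ncard : ℝ) * ((completions s E z x).ncard : ℝ) := by
    exact_mod_cast ncard_spanned_le s E
  have h2 : ∑ u, ∑ v, ((completions s E u v).ncard : ℝ) ≤
      ((s : ℝ) + 2) ^ (s + 2) * E.ncard := by
    exact_mod_cast sum_ncard_completions_le s E
  have h3 : ∑ u, ∑ v, ((completions s E u v).ncard : ℝ) ^ 2 ≤
      (n : ℝ) ^ s * (((s : ℝ) + 2) ^ (s + 2) * E.ncard) := by
    refine le_trans ?_ (mul_le_mul_of_nonneg_left h2 (by positivity))
    simp only [Finset.mul_sum]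
    refine Finset.sum_le_sum fun u _ => Finset.sum_le_sum fun v _ => ?_
    rw [sq]
    refine mul_le_mul_of_nonneg_right ?_ (by positivity)
    exact_mod_cast ncard_completions_le s E u v
  calc ((spanned s E).ncard : ℝ) ^ 2 ≤ _ := pow_le_pow_left₀ (by positivity) h1 2
    _ ≤ _ := sum_triangle_sq_le _
    _ ≤ _ := pow_le_pow_left₀ (by positivity) h3 3

/-! ### Triangles with disjoint rows in a triangle listing -/

lemma ncard_rowEdge {n s : ℕ} (f : Fin 3 × Fin (s + 1) ↪ Fin n) (i : Fin 3) :
    (rowEdge f i).ncard = s + 2 := by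
  have h : Function.Injective fun j => f (i, j) := fun j k h => by simpa using h
  rw [rowEdge, Set.ncard_insert_of_notMem]
  · rw [← Set.image_univ, Set.ncard_image_of_injective _ h, Set.ncard_univ]
    simp
  · rintro ⟨j, hj⟩
    simp at hj

/-- Edge i + 1 meets only the rows i + 1 and i + 2. This makes the triangle induced and also tells
its edges apart. -/
lemma notMem_rowEdge_succ {n s : ℕ} (f : Fin 3 × Fin (s + 1) ↪ Fin n) (i : Fin 3) :
    f (i, 0) ∉ rowEdge f (i + 1) := by
  rintro (h | ⟨j, h⟩)
  · have := congrArg Prod.fst (f.injective h)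
    revert this; clear h; revert i; simp only; decide
  · have := congrArg Prod.fst (f.injective h)
    revert this; clear h; revert i; simp

lemma mem_rowEdge {n s : ℕ} (f : Fin 3 × Fin (s + 1) → Fin n) (i : Fin 3) :
    f (i, 0) ∈ rowEdge f i := Or.inr ⟨0, rfl⟩

lemma rowEdge_injective {n s : ℕ} (f : Fin 3 × Fin (s + 1) ↪ Fin n) :
    Function.Injective (rowEdge f) := by
  intro i j h
  by_contra hij
  have : j = i + 1 ∨ i = j + 1 := by clear h; revert i j; decide
  rcases this with rfl | rfl
  · exact notMem_rowEdge_succ f i (h ▸ mem_rowEdge f i)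
  · exact notMem_rowEdge_succ f j (h ▸ mem_rowEdge f j)

/-- The triangle with edges `rowEdge f i`. -/
def rowTriple {n s : ℕ} (f : Fin 3 × Fin (s + 1) → Fin n) : Triple n where
  v i := f (i, 0)
  e := rowEdge f

lemma isTriangle_rowTriple {n s : ℕ} {H : Hypergraph (Fin n)} {f : Fin 3 × Fin (s + 1) ↪ Fin n}
    (hf : f ∈ spanned s H.edgeSet) (K : TriangleKind) : IsTriangle H (rowTriple f) K := by
  have h1 : (rowTriple f).IsClosedPath H := fun i =>
    ⟨hf i, Or.inl (by simp [rowTriple]), mem_rowEdge f i⟩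
  have h2 : (rowTriple f).IsSimple :=
    ⟨fun i j h => by simpa [rowTriple] using h, rowEdge_injective f⟩
  cases K
  exacts [h1, ⟨h1, h2⟩, ⟨h1, h2, notMem_rowEdge_succ f⟩]

lemma Triple.Same.range_e_subset {n : ℕ} {T T' : Triple n} (h : T.Same T') (i : Fin 3) :
    ∃ j, T.e i = T'.e j := by
  rcases h with ⟨k, h⟩ | ⟨k, h⟩
  · exact ⟨i - k, by rw [(h _).2]; congr 1; clear h; revert i k; decide⟩
  · exact ⟨k - i - 1, by rw [(h _).2]; congr 1; clear h; revert i k; decide⟩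

/-- The edges of the triangles in a set of triangles. -/
def edgesOf {n : ℕ} (S : Set (Triple n)) : Set (Set (Fin n)) := {e | ∃ T ∈ S, ∃ i, T.e i = e}

lemma edgesOf_subset {n : ℕ} {K : TriangleKind} {H : Hypergraph (Fin n)}
    {S : Fin n → Set (Triple n)} (hS : ListsTriangles K H S) (v : Fin n) :
    edgesOf (S v) ⊆ H.edgeSet := by
  rintro e ⟨T, hT, i, rfl⟩
  have := hS.1 v T hT
  cases K
  exacts [(this i).1, (this.1 i).1, (this.1 i).1]

lemma spanned_subset_iUnion {n : ℕ} (s : ℕ) {K : TriangleKind} {H : Hypergraph (Fin n)}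
    {S : Fin n → Set (Triple n)} (hS : ListsTriangles K H S) :
    spanned s H.edgeSet ⊆ ⋃ v, spanned s (edgesOf (S v)) := by
  intro f hf
  obtain ⟨v, T', hT', hs⟩ := hS.2 _ (isTriangle_rowTriple hf K)
  refine Set.mem_iUnion.2 ⟨v, fun i => ?_⟩
  obtain ⟨j, hj⟩ := hs.range_e_subset i
  exact ⟨T', hT', j, hj.symm⟩

/-- Pigeonhole over the n vertices. A vertex is credited with all triangles spanned by the edges in
its output, not only with those it lists. -/
lemma exists_ncard_spanned_ge {n : ℕ} (s : ℕ) {K : TriangleKind} {H : Hypergraph (Fin n)}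
    {S : Fin n → Set (Triple n)} (hS : ListsTriangles K H S) (hn : 0 < n) :
    ∃ v, ((spanned s H.edgeSet).ncard : ℝ) ≤ n * (spanned s (edgesOf (S v))).ncard := by
  have : Nonempty (Fin n) := ⟨⟨0, hn⟩⟩
  obtain ⟨v, hv⟩ := Finite.exists_max fun v => (spanned s (edgesOf (S v))).ncard
  refine ⟨v, ?_⟩
  have h1 : (spanned s H.edgeSet).ncard ≤ ∑ v, (spanned s (edgesOf (S v))).ncard :=
    by
    classical
    simp only [Set.ncard_eq_toFinset_card']
    refine (Finset.card_le_card fun f hf => ?_).trans Finset.card_biUnion_le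
    simpa using spanned_subset_iUnion s hS (by simpa using hf)
  have h2 : ∑ v, (spanned s (edgesOf (S v))).ncard ≤ n * (spanned s (edgesOf (S v))).ncard := by
    refine (Finset.sum_le_card_nsmul _ _ _ fun u _ => hv u).trans_eq ?_
    simp
  exact_mod_cast h1.trans h2

/-! ### Probabilities in the random hypergraph -/

instance instDiscreteMeasurableSpaceHypergraph (n : ℕ) :
    DiscreteMeasurableSpace (Hypergraph (Fin n)) := ⟨fun _ => trivial⟩

instance instFiniteHypergraph (n : ℕ) : Finite (Hypergraph (Fin n)) := by
  refine Finite.of_injective (fun H => (H.vertexSet, H.edgeSet)) fun H H' h => ?_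
  simp only [Prod.mk.injEq] at h
  exact Hypergraph.ext h.1 h.2

lemma setBernoulli_superset {ι : Type*} [Finite ι] {u F : Set ι} (p : unitInterval) (hF : F ⊆ u) :
    setBernoulli u p {s | F ⊆ s} = (unitInterval.toNNReal p : ℝ≥0∞) ^ F.ncard := by
  classical
  have := Fintype.ofFinite ι
  rw [setBernoulli_apply']
  have h : (fun q : ι → Prop => {i | q i}) ⁻¹' {s | F ⊆ s} =
      Set.pi (F.toFinset : Set ι) fun _ => {True} := by
    ext q
    simp [Set.subset_def, Set.mem_pi]
  rw [h, Measure.infinitePi_pi _ (fun _ _ => by measurability), Set.ncard_eq_toFinset_card',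
    ← Finset.prod_const]
  refine Finset.prod_congr rfl fun i hi => ?_
  have : i ∈ u := hF (by simpa using hi)
  simp [this]

lemma randomHypergraph_apply (n r : ℕ) (p : unitInterval) (G : Set (Hypergraph (Fin n))) :
    randomHypergraph n r p G = setBernoulli {e : Set (Fin n) | e.ncard = r} p (ofEdges ⁻¹' G) :=
  Measure.map_apply Measurable.of_discrete trivial

lemma randomHypergraph_ae_uniform (n r : ℕ) (p : unitInterval) :
    ∀ᵐ H ∂randomHypergraph n r p, H.edgeSet ⊆ {e | e.ncard = r} := by
  rw [ae_iff, randomHypergraph_apply]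
  exact ae_iff.1 (setBernoulli_ae_subset (u := {e : Set (Fin n) | e.ncard = r}) (p := p))

lemma toNNReal_half : (unitInterval.toNNReal half : ℝ≥0∞) = 2⁻¹ := by
  have : unitInterval.toNNReal half = 2⁻¹ := by
    ext; simp [half]
  rw [this]
  simp

lemma randomHypergraph_superset {n r : ℕ} {F : Set (Set (Fin n))} (hF : ∀ e ∈ F, e.ncard = r) :
    randomHypergraph n r half {H | F ⊆ H.edgeSet} = 2⁻¹ ^ F.ncard := by
  rw [randomHypergraph_apply, ← toNNReal_half]
  exact setBernoulli_superset half hF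

/-- An arbitrary output may contain sets of the wrong size; these are almost surely not edges, so
the bound persists. -/
lemma randomHypergraph_superset_le (n r : ℕ) (F : Set (Set (Fin n))) :
    randomHypergraph n r half {H | F ⊆ H.edgeSet} ≤ 2⁻¹ ^ F.ncard := by
  by_cases hF : ∀ e ∈ F, e.ncard = r
  · exact (randomHypergraph_superset hF).le
  · push Not at hF
    obtain ⟨e, he, her⟩ := hF
    refine le_of_eq_of_le ?_ zero_le
    refine measure_mono_null ?_ (ae_iff.1 (randomHypergraph_ae_uniform n r half))
    intro H hH h
    exact her (h (hH he))

lemma randomHypergraph_mem_spanned {n s : ℕ} (f : Fin 3 × Fin (s + 1) ↪ Fin n) :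
    (randomHypergraph n (s + 2) half).real {H | f ∈ spanned s H.edgeSet} = 1 / 8 := by
  have h : {H : Hypergraph (Fin n) | f ∈ spanned s H.edgeSet} =
      {H | Set.range (rowEdge f) ⊆ H.edgeSet} := by
    ext H; simp [mem_spanned, Set.range_subset_iff]
  have hc : (Set.range (rowEdge f)).ncard = 3 := by
    rw [← Set.image_univ, Set.ncard_image_of_injective _ (rowEdge_injective f), Set.ncard_univ]
    simp
  rw [measureReal_def, h, randomHypergraph_superset, hc]
  · simp; norm_num
  · rintro _ ⟨i, rfl⟩
    exact ncard_rowEdge f i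

/-- The expected number of triangles is an eighth of the possible number, so that with constant
probability there are many triangles. -/
lemma randomHypergraph_few_triangles (n s : ℕ) :
    (randomHypergraph n (s + 2) half).real
      {H | ((spanned s H.edgeSet).ncard : ℝ) < n.descFactorial (3 * (s + 1)) / 16} ≤ 15 / 16 := by
  classical
  set D := randomHypergraph n (s + 2) half with hD
  set N : ℝ := ((n.descFactorial (3 * (s + 1)) : ℕ) : ℝ) with hN
  have hcard : (Fintype.card (Fin 3 × Fin (s + 1) ↪ Fin n) : ℝ) = N := by
    rw [Fintype.card_embedding_eq]; simp [hN]
  -- The averaging argument divides by `N`; for `N = 0` the event is empty.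
  rcases (show 0 ≤ N by positivity).eq_or_lt with h0 | h0
  · rw [← h0]
    refine le_of_eq_of_le (measureReal_eq_zero_iff .. |>.2 ?_) (by norm_num : (0 : ℝ) ≤ 15 / 16)
    convert measure_empty (μ := D)
    ext H
    simp
  set F : Set (Hypergraph (Fin n)) := {H | ((spanned s H.edgeSet).ncard : ℝ) < N / 16} with hF
  have hint : ∀ (g : Hypergraph (Fin n) → ℝ), Integrable g D := fun g => Integrable.of_finite
  have h1 : ∫ H, ((spanned s H.edgeSet).ncard : ℝ) ∂D = N / 8 := by
    have : ∀ H : Hypergraph (Fin n), ((spanned s H.edgeSet).ncard : ℝ) =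
        ∑ f, Set.indicator {H : Hypergraph (Fin n) | f ∈ spanned s H.edgeSet} (fun _ => (1 : ℝ)) H := by
      intro H
      rw [Set.ncard_eq_toFinset_card']
      simp [Set.indicator_apply]
    simp_rw [this]
    rw [integral_finsetSum _ fun f _ => hint _]
    have : ∀ f : Fin 3 × Fin (s + 1) ↪ Fin n,
        ∫ H, Set.indicator {H : Hypergraph (Fin n) | f ∈ spanned s H.edgeSet}
          (fun _ => (1 : ℝ)) H ∂D = 1 / 8 := by
      intro f
      rw [integral_indicator_const _ (MeasurableSet.of_discrete), randomHypergraph_mem_spanned]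
      simp
    simp_rw [this]
    rw [Finset.sum_const, Finset.card_univ, nsmul_eq_mul, hcard]
    ring
  -- Reverse Markov inequality: the count is at most `N`, and at most `N / 16` on `F`. With mean `N
  -- / 8` this gives `F` probability at most 14/15, which is below 15/16.
  have h2 : ∫ H, ((spanned s H.edgeSet).ncard : ℝ) ∂D ≤
      ∫ H, (N - F.indicator (fun _ => N * (15 / 16)) H) ∂D := by
    refine integral_mono (hint _) (hint _) fun H => ?_
    by_cases hH : H ∈ F
    · have : ((spanned s H.edgeSet).ncard : ℝ) < N / 16 := hH
      simp only [Set.indicator_of_mem hH]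
      linarith
    · simp only [Set.indicator_of_notMem hH, sub_zero]
      rw [← hcard]
      have := Set.ncard_le_card (spanned s H.edgeSet)
      rw [Nat.card_eq_fintype_card] at this
      exact_mod_cast this
  rw [h1, integral_sub (hint _) (hint _), integral_indicator_const _ (MeasurableSet.of_discrete)] at h2
  simp at h2
  nlinarith

/-! ### Counting transcripts -/

/-- A message of at most `B` bits as a word of length `B` over an alphabet of three letters. -/
def Message.letters {B : ℕ} (m : Message B) (i : Fin B) : Option Bool := m.1[(i : ℕ)]?

lemma Message.letters_injective (B : ℕ) :
    Function.Injective (Message.letters : Message B → Fin B → Option Bool) := by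
  rintro ⟨l, hl⟩ ⟨l', hl'⟩ h
  refine Subtype.ext (List.ext_getElem? fun i => ?_)
  by_cases hi : i < B
  · exact congrFun h ⟨i, hi⟩
  · rw [List.getElem?_eq_none (by dsimp only; omega), List.getElem?_eq_none (by dsimp only; omega)]

instance instFiniteMessage (B : ℕ) : Finite (Message B) :=
  Finite.of_injective _ (Message.letters_injective B)

lemma Message.card_le (B : ℕ) : Nat.card (Message B) ≤ 2 ^ (2 * B) := by
  refine (Nat.card_le_card_of_injective _ (Message.letters_injective B)).trans ?_
  simp only [Nat.card_eq_fintype_card, Fintype.card_fun, Fintype.card_option, Fintype.card_bool,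
    Fintype.card_fin]
  -- The three letters give 3 ^ B words, bounded by 4 ^ B.
  rw [pow_mul]
  exact Nat.pow_le_pow_left (by norm_num) _

instance instFiniteTriple (n : ℕ) : Finite (Triple n) := by
  refine Finite.of_injective (fun T => (T.v, T.e)) fun T T' h => ?_
  cases T; cases T'
  simpa using h

lemma ncard_setOf_mem_le {n : ℕ} (s : ℕ) (v : Fin n) :
    {e : Set (Fin n) | e.ncard = s + 2 ∧ v ∈ e}.ncard ≤ n ^ (s + 1) := by
  have h : {e : Set (Fin n) | e.ncard = s + 2 ∧ v ∈ e} ⊆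
      Set.range fun a : Fin (s + 1) → Fin n => insert v (Set.range a) := by
    rintro e ⟨he, hv⟩
    have h1 : (e \ {v}).ncard = s + 1 := by
      rw [Set.ncard_sdiff_singleton_of_mem hv, he]; rfl
    have h2 : Nat.card (e \ {v} : Set (Fin n)) = s + 1 := h1
    let φ := Finite.equivFinOfCardEq h2
    refine ⟨fun i => (φ.symm i : Fin n), ?_⟩
    have : (Set.range fun i => (φ.symm i : Fin n)) = e \ {v} := by
      rw [show (fun i => (φ.symm i : Fin n)) = Subtype.val ∘ φ.symm from rfl,
        φ.symm.surjective.range_comp, Subtype.range_coe]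
    simp only [this]
    simp [Set.insert_eq_of_mem hv]
  refine (Set.ncard_le_ncard h).trans ?_
  rw [← Set.image_univ]
  refine (Set.ncard_image_le).trans ?_
  simp [Set.ncard_univ]

namespace Algorithm

variable {n B : ℕ} {Ω : Type*} [MeasurableSpace Ω] (A : Algorithm n B Ω) (M : Model)

lemma length_history (H : Hypergraph (Fin n)) (ω : Ω) (t : ℕ) (v : Fin n) :
    (A.history M H ω t v).length = t := by
  induction t with
  | zero => rfl
  | succ t ih => simp [history, ih]

lemma history_eq_take (H : Hypergraph (Fin n)) (ω : Ω) {t T : ℕ} (h : t ≤ T) (v : Fin n) :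
    A.history M H ω t v = (A.history M H ω T v).take t := by
  induction T, h using Nat.le_induction with
  | base => rw [List.take_of_length_le (A.length_history M H ω t v).le]
  | succ T hT ih =>
    rw [history, List.take_append_of_le_length (by rwa [length_history])]
    exact ih

-- The output depends on the network only through the incident edges and the history up to `T`:
-- earlier histories are prefixes, so all decisions agree up to that time.
variable {A M} in
lemma TerminatesWith.unique {H H' : Hypergraph (Fin n)} {ω : Ω} {v : Fin n} {t t' T : ℕ}
    {S S' : Set (Triple n)} (h : A.TerminatesWith M H ω v t S)
    (h' : A.TerminatesWith M H' ω v t' S') (ht : t ≤ T) (ht' : t' ≤ T)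
    (hI : incidentEdges H v = incidentEdges H' v)
    (hh : A.history M H ω T v = A.history M H' ω T v) : S = S' := by
  have key : ∀ s ≤ T, A.decision M H ω s v = A.decision M H' ω s v := fun s hs => by
    rw [decision, decision, hI, history_eq_take A M H ω hs, history_eq_take A M H' ω hs, hh]
  rcases lt_trichotomy t t' with hlt | rfl | hlt
  · have := h'.2 t hlt
    rw [← key t ht, h.1] at this
    cases this
  · have := h.1
    rw [key t ht, h'.1] at this
    exact (Option.some.inj this).symm
  · have := h.2 t' hlt
    rw [key t' ht', h'.1] at this
    cases this

/-- All vertices terminate within `T` rounds, and their outputs solve triangle listing. -/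
def SucceedsWithin (K : TriangleKind) (T : ℕ) (H : Hypergraph (Fin n)) (ω : Ω) : Prop :=
  ∃ S : Fin n → Set (Triple n),
    (∀ v, ∃ t ≤ T, A.TerminatesWith M H ω v t (S v)) ∧ ListsTriangles K H S

/-- `v` terminates within `T` rounds, and its output consists of triangles of `H` which involve at
least `m` edges. -/
def Reveals (m T : ℕ) (v : Fin n) (H : Hypergraph (Fin n)) (ω : Ω) : Prop :=
  ∃ S : Set (Triple n), (∃ t ≤ T, A.TerminatesWith M H ω v t S) ∧ edgesOf S ⊆ H.edgeSet ∧
    m ≤ (edgesOf S).ncard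

/-- All networks in this event give `v` the same output, so they all contain one fixed set of at
least `m` edges. -/
lemma measure_reveals_transcript_le (r m T : ℕ) (v : Fin n) (ω : Ω) (I : Set (Set (Fin n)))
    (h : History n B) :
    randomHypergraph n r half {H | A.Reveals M m T v H ω ∧ incidentEdges H v = I ∧
      A.history M H ω T v = h} ≤ 2⁻¹ ^ m := by
  rcases Set.eq_empty_or_nonempty {H | A.Reveals M m T v H ω ∧ incidentEdges H v = I ∧
      A.history M H ω T v = h} with he | ⟨H₀, ⟨S₀, ⟨t₀, ht₀, hS₀⟩, -, hm⟩, hI₀, hh₀⟩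
  · rw [he]; simp
  · calc _ ≤ randomHypergraph n r half {H | edgesOf S₀ ⊆ H.edgeSet} := by
          refine measure_mono ?_
          rintro H ⟨⟨S, ⟨t, ht, hS⟩, hsub, -⟩, hI, hh⟩
          rw [hS₀.unique hS ht₀ ht (hI₀.trans hI.symm) (hh₀.trans hh.symm)]
          exact hsub
      _ ≤ 2⁻¹ ^ (edgesOf S₀).ncard := randomHypergraph_superset_le _ _ _
      _ ≤ 2⁻¹ ^ m := pow_le_pow_right_of_le_one' (by simp) hm

lemma measure_reveals_le (s m T : ℕ) (v : Fin n) (ω : Ω) :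
    randomHypergraph n (s + 2) half {H | A.Reveals M m T v H ω} ≤
      2 ^ (n ^ (s + 1) + 2 * B * n * T) * 2⁻¹ ^ m := by
  classical
  have := Fintype.ofFinite (Message B)
  set U : Set (Set (Fin n)) := {e : Set (Fin n) | e.ncard = s + 2 ∧ v ∈ e} with hU
  set J := Finset.univ.filter (· ⊆ U) ×ˢ (Finset.univ : Finset (Fin T → Fin n → Message B)) with hJ
  have hJc : J.card ≤ 2 ^ (n ^ (s + 1) + 2 * B * n * T) := by
    rw [hJ, Finset.card_product, pow_add]
    refine Nat.mul_le_mul ?_ ?_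
    · have : (Finset.univ.filter (· ⊆ U)).card = 2 ^ U.ncard := by
        rw [← Set.ncard_powerset U (Set.toFinite _), ← Set.ncard_coe_finset]
        congr 1; ext; simp
      rw [this]
      exact Nat.pow_le_pow_right (by norm_num) (ncard_setOf_mem_le s v)
    · have := Message.card_le B
      rw [Nat.card_eq_fintype_card] at this
      simp only [Finset.card_univ, Fintype.card_fun, Fintype.card_fin]
      rw [← pow_mul, mul_assoc (2 * B), pow_mul 2]
      exact Nat.pow_le_pow_left this _
  calc _ ≤ randomHypergraph n (s + 2) half (⋃ q ∈ J, {H | A.Reveals M m T v H ω ∧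
          incidentEdges H v = q.1 ∧ A.history M H ω T v = List.ofFn q.2}) := by
        -- Only almost surely are all incident edges of size s + 2, as membership in `J` demands.
        refine measure_mono_ae ?_
        filter_upwards [randomHypergraph_ae_uniform n (s + 2) half] with H hH hR
        refine Set.mem_iUnion₂.2 ⟨(incidentEdges H v, fun i =>
          (A.history M H ω T v).get (i.cast (A.length_history M H ω T v).symm)), ?_, hR, rfl, ?_⟩
        · simp only [hJ, Finset.mem_product, Finset.mem_filter, Finset.mem_univ, true_and, and_true]
          exact fun e he => ⟨hH he.1, he.2⟩
        · refine List.ext_get (by simp [length_history]) fun i h1 h2 => by simp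
    _ ≤ ∑ q ∈ J, randomHypergraph n (s + 2) half {H | A.Reveals M m T v H ω ∧
          incidentEdges H v = q.1 ∧ A.history M H ω T v = List.ofFn q.2} :=
        measure_biUnion_finset_le _ _
    _ ≤ ∑ q ∈ J, 2⁻¹ ^ m := Finset.sum_le_sum fun q _ =>
        A.measure_reveals_transcript_le M _ _ _ _ _ _ _
    _ = J.card * 2⁻¹ ^ m := by rw [Finset.sum_const, nsmul_eq_mul]
    _ ≤ _ := by gcongr; exact_mod_cast hJc

/-- If the triangles that one vertex has to list involve at least `m` edges, then for fixed random
choices listing in few rounds succeeds with probability bounded away from `1`. -/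
lemma measure_succeedsWithin_le (K : TriangleKind) {s m T : ℕ} (ω : Ω) (hn : 0 < n)
    (hm : ∀ E : Set (Set (Fin n)),
      (n.descFactorial (3 * (s + 1)) : ℝ) / 16 ≤ n * (spanned s E).ncard → m ≤ E.ncard) :
    randomHypergraph n (s + 2) half {H | A.SucceedsWithin M K T H ω} ≤
      ENNReal.ofReal (15 / 16) + n * (2 ^ (n ^ (s + 1) + 2 * B * n * T) * 2⁻¹ ^ m) := by
  set D := randomHypergraph n (s + 2) half with hD
  set F := {H : Hypergraph (Fin n) |
    ((spanned s H.edgeSet).ncard : ℝ) < (n.descFactorial (3 * (s + 1)) : ℝ) / 16} with hF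
  calc D {H | A.SucceedsWithin M K T H ω} ≤ D (F ∪ ⋃ v, {H | A.Reveals M m T v H ω}) := by
        refine measure_mono ?_
        rintro H ⟨S, hS, hL⟩
        by_cases hH : H ∈ F
        · exact Or.inl hH
        · obtain ⟨v, hv⟩ := exists_ncard_spanned_ge s hL hn
          exact Or.inr (Set.mem_iUnion.2 ⟨v, S v, hS v, edgesOf_subset hL v,
            hm _ ((not_lt.1 hH).trans hv)⟩)
    _ ≤ D F + ∑ v, D {H | A.Reveals M m T v H ω} :=
        (measure_union_le _ _).trans (by gcongr; exact measure_iUnion_fintype_le _ _)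
    _ ≤ _ := by
        gcongr
        · rw [← ofReal_measureReal]
          exact ENNReal.ofReal_le_ofReal (randomHypergraph_few_triangles n s)
        · refine (Finset.sum_le_card_nsmul _ _ _ fun v _ =>
            A.measure_reveals_le M s m T v ω).trans_eq ?_
          simp

end Algorithm

namespace Algorithm

variable {n B : ℕ} {Ω : Type*} [MeasurableSpace Ω] (A : Algorithm n B Ω) (M : Model)

/-! ### Measurability and the expected number of rounds -/

/-- Histories take countably many values, so one can split according to the previous histories and
the messages then sent. -/
lemma measurableSet_history (H : Hypergraph (Fin n)) (t : ℕ) (h : Fin n → History n B) :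
    MeasurableSet {ω | A.history M H ω t = h} := by
  classical
  induction t generalizing h with
  | zero =>
    have : ∀ ω, A.history M H ω 0 = fun _ => [] := fun ω => funext fun v => rfl
    simp only [this]
    exact MeasurableSet.const _
  | succ t ih =>
    have : {ω | A.history M H ω (t + 1) = h} = ⋃ g : Fin n → History n B,
        {ω | A.history M H ω t = g} ∩ ⋃ m : Fin n → Fin n → Message B,
          (⋂ v, ⋂ u, {ω | A.send u v ω (incidentEdges H u) (g u) = m v u}) ∩
          {_ω | ∀ v, g v ++ [fun u => if M.CanSend H u v then m v u else Message.silence] = h v} := by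
      ext ω
      simp only [Set.mem_iUnion, Set.mem_inter_iff, Set.mem_iInter, Set.mem_ofPred_eq]
      constructor
      · rintro rfl
        exact ⟨_, rfl, _, fun v u => rfl, fun v => rfl⟩
      · rintro ⟨g, rfl, m, hm, hh⟩
        funext v
        rw [← hh v, history]
        simp only [hm]
    rw [this]
    refine MeasurableSet.iUnion fun g => (ih g).inter (MeasurableSet.iUnion fun m => ?_)
    refine MeasurableSet.inter ?_ (MeasurableSet.const _)
    exact MeasurableSet.iInter fun v => MeasurableSet.iInter fun u => A.measurable_send _ _ _ _ _

lemma measurableSet_decision (H : Hypergraph (Fin n)) (t : ℕ) (v : Fin n)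
    (o : Option (Set (Triple n))) : MeasurableSet {ω | A.decision M H ω t v = o} := by
  have : {ω | A.decision M H ω t v = o} = ⋃ g : Fin n → History n B,
      {ω | A.history M H ω t = g} ∩ {ω | A.decide v ω (incidentEdges H v) (g v) = o} := by
    ext ω
    simp [decision]
  rw [this]
  exact MeasurableSet.iUnion fun g =>
    (A.measurableSet_history M H t g).inter (A.measurable_decide _ _ _ _)

lemma measurableSet_terminatesWith (H : Hypergraph (Fin n)) (v : Fin n) (t : ℕ)
    (S : Set (Triple n)) : MeasurableSet {ω | A.TerminatesWith M H ω v t S} := by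
  have : {ω | A.TerminatesWith M H ω v t S} = {ω | A.decision M H ω t v = some S} ∩
      ⋂ s, ⋂ _ : s < t, {ω | A.decision M H ω s v = none} := by
    ext ω; simp [TerminatesWith]
  rw [this]
  exact (A.measurableSet_decision M H t v _).inter (MeasurableSet.iInter fun s =>
    MeasurableSet.iInter fun _ => A.measurableSet_decision M H s v _)

lemma measurableSet_succeedsWithin (K : TriangleKind) (T : ℕ) (H : Hypergraph (Fin n)) :
    MeasurableSet {ω | A.SucceedsWithin M K T H ω} := by
  have : {ω | A.SucceedsWithin M K T H ω} = ⋃ S : Fin n → Set (Triple n),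
      (⋂ v, ⋃ t, ⋃ _ : t ≤ T, {ω | A.TerminatesWith M H ω v t (S v)}) ∩
        {_ω | ListsTriangles K H S} := by
    ext ω; simp [SucceedsWithin]
  rw [this]
  exact MeasurableSet.iUnion fun S => MeasurableSet.inter (MeasurableSet.iInter fun v =>
    MeasurableSet.iUnion fun t => MeasurableSet.iUnion fun _ =>
      A.measurableSet_terminatesWith M H v t _) (MeasurableSet.const _)

/-- Every vertex terminates within `T` rounds. -/
def HaltsWithin (T : ℕ) (H : Hypergraph (Fin n)) (ω : Ω) : Prop :=
  ∀ v, ∃ t ≤ T, ∃ S, A.TerminatesWith M H ω v t S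

lemma measurableSet_haltsWithin (T : ℕ) (H : Hypergraph (Fin n)) :
    MeasurableSet {ω | A.HaltsWithin M T H ω} := by
  have : {ω | A.HaltsWithin M T H ω} =
      ⋂ v, ⋃ t, ⋃ _ : t ≤ T, ⋃ S, {ω | A.TerminatesWith M H ω v t S} := by
    ext ω; simp [HaltsWithin]
  rw [this]
  exact MeasurableSet.iInter fun v => MeasurableSet.iUnion fun t => MeasurableSet.iUnion fun _ =>
    MeasurableSet.iUnion fun S => A.measurableSet_terminatesWith M H v t S

lemma lt_rounds_of_not_haltsWithin {T : ℕ} {H : Hypergraph (Fin n)} {ω : Ω}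
    (h : ¬ A.HaltsWithin M T H ω) : (T + 1 : ℕ) ≤ A.rounds M H ω := by
  simp only [HaltsWithin, not_forall, not_exists, not_and] at h
  obtain ⟨v, hv⟩ := h
  refine le_trans (le_sInf ?_) (le_iSup (fun v => sInf {τ : ℕ∞ | ∃ (t : ℕ) (S : Set (Triple n)),
    A.TerminatesWith M H ω v t S ∧ τ = (t : ℕ∞)}) v)
  rintro τ ⟨t, S, hS, rfl⟩
  have : ¬ t ≤ T := fun ht => hv t ht S hS
  exact_mod_cast (by omega : T + 1 ≤ t)

lemma succeedsWithin_of_succeeds {K : TriangleKind} {T : ℕ} {H : Hypergraph (Fin n)} {ω : Ω}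
    (hs : A.Succeeds M K H ω) (hh : A.HaltsWithin M T H ω) : A.SucceedsWithin M K T H ω := by
  obtain ⟨S, hS, hL⟩ := hs
  refine ⟨S, fun v => ?_, hL⟩
  obtain ⟨t, ht⟩ := hS v
  obtain ⟨t', ht', S', hS'⟩ := hh v
  have : S v = S' := ht.unique hS' (le_max_left t t') (le_max_right t t') rfl rfl
  exact ⟨t', ht', this ▸ hS'⟩

lemma measurableSet_of_sections {X : Set (Hypergraph (Fin n) × Ω)}
    (h : ∀ H, MeasurableSet {ω | (H, ω) ∈ X}) : MeasurableSet X := by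
  have : X = ⋃ H, {H} ×ˢ {ω | (H, ω) ∈ X} := by
    ext ⟨H, ω⟩; simp
  rw [this]
  exact MeasurableSet.iUnion fun H => MeasurableSet.prod (MeasurableSet.of_discrete) (h H)

/-- If for all random choices success within `T` rounds has probability at most `β`, then an
algorithm that succeeds with probability at least `β + δ` needs more than `δ T` rounds in
expectation. -/
lemma expectedRounds_ge (K : TriangleKind) (T : ℕ) (D : Measure (Hypergraph (Fin n)))
    [IsProbabilityMeasure D] (P : Measure Ω) [IsProbabilityMeasure P] {β δ : ℝ≥0∞} (hβ : β ≠ ∞)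
    (h : ∀ ω, D {H | A.SucceedsWithin M K T H ω} ≤ β)
    (hs : β + δ ≤ A.successProbability M K D P) :
    (T + 1 : ℕ) * δ ≤ A.expectedRounds M D P := by
  set X : Set (Hypergraph (Fin n) × Ω) := {x | A.SucceedsWithin M K T x.1 x.2} with hX
  set Y : Set (Hypergraph (Fin n) × Ω) := {x | ¬ A.HaltsWithin M T x.1 x.2} with hY
  have hXm : MeasurableSet X := measurableSet_of_sections fun H =>
    A.measurableSet_succeedsWithin M K T H
  have hYm : MeasurableSet Y := measurableSet_of_sections fun H =>
    (A.measurableSet_haltsWithin M T H).compl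
  have h1 : D.prod P X ≤ β := by
    rw [Measure.prod_apply_symm hXm]
    calc _ ≤ ∫⁻ _, β ∂P := lintegral_mono fun ω => h ω
      _ = β := by simp
  have h2 : β + δ ≤ β + D.prod P Y := by
    refine hs.trans ((measure_mono ?_).trans ((measure_union_le X Y).trans (by gcongr)))
    -- A successful run either halts within `T` rounds, and so succeeds within them, or is one of
    -- the long runs in `Y`.
    intro x hx
    by_cases hh : A.HaltsWithin M T x.1 x.2
    · exact Or.inl (A.succeedsWithin_of_succeeds M hx hh)
    · exact Or.inr hh
  have h3 : δ ≤ D.prod P Y := (ENNReal.add_le_add_iff_left hβ).1 h2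
  calc ((T + 1 : ℕ) : ℝ≥0∞) * δ ≤ (T + 1 : ℕ) * D.prod P Y := by gcongr
    _ = ∫⁻ x, Y.indicator (fun _ => ((T + 1 : ℕ) : ℝ≥0∞)) x ∂(D.prod P) := by
        rw [lintegral_indicator_const hYm]
    _ ≤ A.expectedRounds M D P := by
        refine lintegral_mono fun x => ?_
        by_cases hx : x ∈ Y
        · rw [Set.indicator_of_mem hx]
          have := A.lt_rounds_of_not_haltsWithin M hx
          rw [← ENat.toENNReal_coe]
          exact ENat.toENNReal_le.2 this
        · rw [Set.indicator_of_notMem hx]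
          exact zero_le

end Algorithm

/-! ### Asymptotics -/

/-- The constant in the lower bound for the number of edges that span a `1 / n` fraction of the
triangles. -/
noncomputable def edgeConst (s : ℕ) : ℝ :=
  ((2 ^ (6 * s + 14) * ((s : ℝ) + 2) ^ (3 * (s + 2)))⁻¹) ^ (1 / 3 : ℝ)

lemma edgeConst_pos (s : ℕ) : 0 < edgeConst s := by
  unfold edgeConst; positivity

lemma edgeConst_pow (s : ℕ) :
    edgeConst s ^ 3 = (2 ^ (6 * s + 14) * ((s : ℝ) + 2) ^ (3 * (s + 2)))⁻¹ := by
  rw [edgeConst, ← Real.rpow_natCast, ← Real.rpow_mul (by positivity)]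
  norm_num

lemma half_pow_le_descFactorial {n k : ℕ} (h : 2 * k ≤ n) :
    ((n : ℝ) / 2) ^ k ≤ n.descFactorial k := by
  have h1 : ((n + 1 - k : ℕ) : ℝ) ^ k ≤ n.descFactorial k := by
    exact_mod_cast n.pow_sub_le_descFactorial k
  refine le_trans (pow_le_pow_left₀ (by positivity) ?_ k) h1
  have : (n : ℝ) ≤ 2 * (n + 1 - k : ℕ) := by exact_mod_cast (by omega : n ≤ 2 * (n + 1 - k))
  linarith

lemma edgeConst_mul_le_ncard {n s : ℕ} (hn : 6 * (s + 1) ≤ n) (E : Set (Set (Fin n)))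
    (hE : (n.descFactorial (3 * (s + 1)) : ℝ) / 16 ≤ n * (spanned s E).ncard) :
    edgeConst s * ((n : ℝ) ^ (s + 1) * (n : ℝ) ^ (1 / 3 : ℝ)) ≤ E.ncard := by
  have hn0 : (0 : ℝ) < n := by exact_mod_cast (by omega : 0 < n)
  have h1 := half_pow_le_descFactorial (n := n) (k := 3 * (s + 1)) (by omega)
  have h2 : (n : ℝ) ^ (3 * s + 2) / 2 ^ (3 * s + 7) ≤ (spanned s E).ncard := by
    have h3 : (n : ℝ) * ((n : ℝ) ^ (3 * s + 2) / 2 ^ (3 * s + 7)) =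
        ((n : ℝ) / 2) ^ (3 * (s + 1)) / 16 := by
      rw [div_pow, show 3 * (s + 1) = (3 * s + 2) + 1 by ring,
        show 3 * s + 7 = ((3 * s + 2) + 1) + 4 by ring, pow_add (2 : ℝ) (3 * s + 2 + 1) 4,
        pow_succ (n : ℝ)]
      norm_num
      field_simp
      ring
    refine le_of_mul_le_mul_left ?_ hn0
    rw [h3]
    linarith
  have h4 := (pow_le_pow_left₀ (by positivity) h2 2).trans (ncard_spanned_sq_le s E)
  have hy : ((n : ℝ) ^ (1 / 3 : ℝ)) ^ 3 = n := by
    rw [← Real.rpow_natCast, ← Real.rpow_mul hn0.le]; norm_num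
  refine le_of_pow_le_pow_left₀ (n := 3) (by norm_num) (by positivity) ?_
  rw [mul_pow, mul_pow, hy, edgeConst_pow, inv_mul_le_iff₀ (by positivity)]
  -- Multiplying by n^(3s) turns the cubed claim into the squared triangle count of `h4`, whose
  -- bound carries the factor (n^s)^3.
  have h5 : (n : ℝ) ^ (3 * s) * ((((n : ℝ) ^ (s + 1)) ^ 3 * n)) =
      ((n : ℝ) ^ (3 * s + 2)) ^ 2 := by ring
  have h6 : ((2 : ℝ) ^ (3 * s + 7)) ^ 2 = 2 ^ (6 * s + 14) := by ring
  refine le_of_mul_le_mul_left ?_ (by positivity : (0 : ℝ) < (n : ℝ) ^ (3 * s))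
  rw [h5]
  rw [div_pow, div_le_iff₀ (by positivity), h6] at h4
  refine h4.trans_eq ?_
  rw [mul_pow, mul_pow, ← pow_mul, ← pow_mul, mul_comm s 3, mul_comm (s + 2) 3]
  ring

lemma union_bound_le {n a m : ℕ} (h : n + a + 5 ≤ m) :
    (n : ℝ≥0∞) * (2 ^ a * 2⁻¹ ^ m) ≤ ENNReal.ofReal (1 / 32) := by
  have h2 : ∀ k : ℕ, (2 : ℝ≥0∞) ^ k * 2⁻¹ ^ k = 1 := fun k => by
    rw [← mul_pow, ENNReal.mul_inv_cancel (by norm_num) (by norm_num), one_pow]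
  calc (n : ℝ≥0∞) * (2 ^ a * 2⁻¹ ^ m) ≤ 2 ^ n * (2 ^ a * 2⁻¹ ^ (n + a + 5)) := by
        have h1 : (n : ℝ≥0∞) ≤ 2 ^ n := by exact_mod_cast Nat.lt_two_pow_self.le
        exact mul_le_mul' h1 (mul_le_mul_right (pow_le_pow_right_of_le_one' (by simp) h) _)
    _ = (2 ^ n * 2⁻¹ ^ n) * (2 ^ a * 2⁻¹ ^ a) * 2⁻¹ ^ 5 := by rw [pow_add, pow_add]; ring
    _ = ENNReal.ofReal (1 / 32) := by
        rw [h2, h2, one_mul, one_mul, ← ENNReal.inv_pow, one_div, ENNReal.ofReal_inv_of_pos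
          (by norm_num)]
        norm_num

/-! ### Choice of parameters and the lower bound -/

lemma expectedRounds_lower_bound {n s B : ℕ} {C : ℝ} (hn : 6 * (s + 1) ≤ n)
    (hy : 14 / edgeConst s ≤ (n : ℝ) ^ (1 / 3 : ℝ)) (hB : (B : ℝ) ≤ C * Real.log n)
    {Ω : Type*} [MeasurableSpace Ω] (P : Measure Ω) [IsProbabilityMeasure P]
    (A : Algorithm n B Ω) (M : Model) (K : TriangleKind)
    (hA : ENNReal.ofReal (63 / 64) ≤ A.successProbability M K (randomHypergraph n (s + 2) half) P) :
    ENNReal.ofReal (edgeConst s / (4 * (|C| + 1)) / 64 *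
        ((n : ℝ) ^ s * (n : ℝ) ^ (1 / 3 : ℝ) / Real.log n)) ≤
      A.expectedRounds M (randomHypergraph n (s + 2) half) P := by
  have hγ := edgeConst_pos s
  set γ := edgeConst s
  set y := (n : ℝ) ^ (1 / 3 : ℝ)
  -- Chosen so that the message term 2BnT uses at most half of the exponent `m`. The other terms sum
  -- to at most 7 n^(s+1), which fits in the other half because γ y ≥ 14.
  set c := γ / (4 * (|C| + 1)) with hc
  have hc0 : 0 < c := by positivity
  have hn1 : (1 : ℝ) < n := by exact_mod_cast (by omega : 1 < n)
  have hlog : 0 < Real.log n := Real.log_pos hn1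
  have hy0 : 0 < y := lt_of_lt_of_le (by positivity) hy
  set x := c * ((n : ℝ) ^ s * y / Real.log n) with hx
  have hx0 : 0 ≤ x := by positivity
  set T := ⌊x⌋₊ with hT
  set m := ⌈γ * ((n : ℝ) ^ (s + 1) * y)⌉₊ with hm
  have hTx : (T : ℝ) ≤ x := Nat.floor_le hx0
  have hBT : (B : ℝ) * T ≤ C * c * ((n : ℝ) ^ s * y) := by
    calc (B : ℝ) * T ≤ (C * Real.log n) * x :=
          mul_le_mul hB hTx (by positivity) (le_trans (by positivity) hB)
      _ = _ := by rw [hx]; field_simp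
  have hCc : C * c ≤ γ / 4 := by
    have h1 : C ≤ |C| + 1 := (le_abs_self C).trans (by linarith)
    have h2 : c * (|C| + 1) = γ / 4 := by rw [hc]; field_simp
    nlinarith
  have hpow : (n : ℝ) ≤ (n : ℝ) ^ (s + 1) := le_self_pow₀ hn1.le (by omega)
  have hmain : n + (n ^ (s + 1) + 2 * B * n * T) + 5 ≤ m := by
    have : ((n + (n ^ (s + 1) + 2 * B * n * T) + 5 : ℕ) : ℝ) ≤ γ * ((n : ℝ) ^ (s + 1) * y) := by
      push_cast
      have h1 : 2 * (B : ℝ) * n * T ≤ γ / 2 * ((n : ℝ) ^ (s + 1) * y) := by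
        calc 2 * (B : ℝ) * n * T = 2 * n * (B * T) := by ring
          _ ≤ 2 * n * (C * c * ((n : ℝ) ^ s * y)) := by gcongr
          _ ≤ 2 * n * (γ / 4 * ((n : ℝ) ^ s * y)) := by gcongr
          _ = _ := by ring
      have h2 : 14 ≤ γ * y := by rwa [div_le_iff₀' hγ] at hy
      have h3 : 14 * (n : ℝ) ^ (s + 1) ≤ γ * y * (n : ℝ) ^ (s + 1) := by gcongr
      nlinarith
    exact Nat.cast_le.1 (this.trans (Nat.le_ceil _))
  have hβ : ∀ ω, randomHypergraph n (s + 2) half {H | A.SucceedsWithin M K T H ω} ≤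
      ENNReal.ofReal (31 / 32) := fun ω => by
    refine (A.measure_succeedsWithin_le M K ω (by omega) (m := m) fun E hE =>
      Nat.ceil_le.2 (edgeConst_mul_le_ncard hn E hE)).trans ?_
    refine (add_le_add_right (union_bound_le hmain) _).trans_eq ?_
    rw [← ENNReal.ofReal_add (by norm_num) (by norm_num)]
    norm_num
  have hδ : ENNReal.ofReal (31 / 32) + ENNReal.ofReal (1 / 64) ≤
      A.successProbability M K (randomHypergraph n (s + 2) half) P := by
    refine le_of_eq_of_le ?_ hA
    rw [← ENNReal.ofReal_add (by norm_num) (by norm_num)]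
    norm_num
  refine le_trans ?_ (A.expectedRounds_ge M K T _ P ENNReal.ofReal_ne_top hβ hδ)
  rw [← ENNReal.ofReal_natCast, ← ENNReal.ofReal_mul (by positivity)]
  refine ENNReal.ofReal_le_ofReal ?_
  -- Failing to halt within `T` rounds costs `T + 1` of them, so rounding `x` down loses nothing.
  have h1 : x ≤ (T + 1 : ℕ) := by push_cast; exact (Nat.lt_floor_add_one x).le
  have h2 : c / 64 * ((n : ℝ) ^ s * y / Real.log n) = x * (1 / 64) := by rw [hx]; ring
  rw [h2]
  gcongr

end HypergraphTriangles

theorem theorem3p2 (r : ℕ) (hr : 2 ≤ r) :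
    ∃ p : ℝ, 0 < p ∧ p < 1 ∧
      ∀ C : ℝ, ∃ c : ℝ, 0 < c ∧
        ∀ᶠ n : ℕ in atTop, ∀ B : ℕ, (B : ℝ) ≤ C * Real.log n →
          ∀ (Ω : Type*) [MeasurableSpace Ω] (P : Measure Ω) [IsProbabilityMeasure P]
            (A : HypergraphTriangles.Algorithm n B Ω) (M : HypergraphTriangles.Model)
            (K : HypergraphTriangles.TriangleKind),
            ENNReal.ofReal p ≤ A.successProbability M K
                (HypergraphTriangles.randomHypergraph n r HypergraphTriangles.half) P →
            ENNReal.ofReal (c * ((n : ℝ) ^ ((r : ℝ) - 5 / 3) / Real.log n)) ≤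
              A.expectedRounds M
                (HypergraphTriangles.randomHypergraph n r HypergraphTriangles.half) P := by
  obtain ⟨s, rfl⟩ := Nat.exists_eq_add_of_le' hr
  have hγ := HypergraphTriangles.edgeConst_pos s
  -- Fast success has probability at most 15/16 + 1/32 = 31/32; the excess 1/64 is the probability
  -- of a long run and reappears as a factor of the constant.
  refine ⟨63 / 64, by norm_num, by norm_num, fun C =>
    ⟨HypergraphTriangles.edgeConst s / (4 * (|C| + 1)) / 64, by positivity, ?_⟩⟩
  have hlim : Tendsto (fun n : ℕ => (n : ℝ) ^ (1 / 3 : ℝ)) atTop atTop :=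
    (tendsto_rpow_atTop (by norm_num)).comp tendsto_natCast_atTop_atTop
  filter_upwards [eventually_ge_atTop (6 * (s + 1)),
    hlim.eventually_ge_atTop (14 / HypergraphTriangles.edgeConst s)] with n hn hy
  intro B hB Ω _ P _ A M K hA
  have hn0 : (0 : ℝ) < n := by exact_mod_cast (by omega : 0 < n)
  have hexp : (n : ℝ) ^ (((s + 2 : ℕ) : ℝ) - 5 / 3) = (n : ℝ) ^ s * (n : ℝ) ^ (1 / 3 : ℝ) := by
    rw [← Real.rpow_natCast, ← Real.rpow_add hn0]
    congr 1
    push_cast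
    ring
  rw [hexp]
  exact HypergraphTriangles.expectedRounds_lower_bound hn hy hB P A M K hA
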